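/- \textbf{Setting.} Let $\mathcal L$ be a lattice: an infinite graph drawn in a finite-dimensional Euclidean space, with directed or undirected edges, such that (I) there are finitely many equivalence classes $\mathcal V_1,\dots,\mathcal V_K$ of vertices under the translations of $\mathcal L$ (the vectors by which translation maps the drawn graph onto itself), (II) every vertex has finite (out-)degree, and (III) any two vertices are connected by a walk. Let $\mathcal E_1,\dots,\mathcal E_d$ be the (finitely many) equivalence classes of edges under translations. An $n$-step walk is a sequence $(v_0,e_1,v_1,\dots,e_n,v_n)$ in which $e_i$ leads from $v_{i-1}$ to $v_i$; it is a self-avoiding walk (SAW) if its vertices are distinct, and a self-avoiding trail (SAT) if its edges are distinct. A single vertex is a $0$-step walk. Fix one of the two kinds, SAW or SAT; below, ``SAW'' means a walk of this kind. For $\mathbf z\in\mathbb R_{>0}^d$ the weight of a walk $\gamma$ is $\mathbf w(\gamma)=\prod_{i=1}^d \mathbf z_i^{N_i(\gamma)}$, where $N_i(\gamma)$ is the number of edges of $\gamma$ in $\mathcal E_i$. A symmetry of $\mathcal L$ (a graph automorphism, acting on vertices and edges) is weight-preserving with respect to $\mathbf z$ if every edge has the same weight as its image. Let $0\le m<n$,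 and fix a representative $v_k\in\mathcal V_k$ for each $k$. Let $\mathcal P=\{\mathcal P_1,\dots,\mathcal P_t\}$ be a partition of the set of all $m$-step SAWs starting from one of $v_1,\dots,v_K$, and fix $\gamma_r\in\mathcal P_r$ for each $r$. We call $\mathcal P$ compatible with $\mathbf z\in\mathbb R_{>0}^d$ if any two walks in the same part are related by a symmetry of $\mathcal L$ that is weight-preserving with respect to $\mathbf z$. Let $\mathbf G^{\mathcal P}_{\mathbf z}(m,n)$ be the $t\times t$ matrix with entries $\mathbf F_{rs}/\mathbf w(\gamma_r)$, where $\mathbf F_{rs}$ is the sum of the weights of all $n$-step SAWs whose first $m$ steps form $\gamma_r$ and whose last $m$ steps form a translation of some walk in $\mathcal P_s$. A square matrix is primitive if it is nonnegative and some positive power of it is entrywise positive; then $\lambda_1$ denotes its dominant eigenvalue, i.e. the real eigenvalue that strictly exceeds the absolute values of all other complex eigenvalues. Put $$\mathcal D^{\mathcal P}(m,n):=\bigcup_{\mathbf z}\ \prod_{i=1}^d[-\mathbf z_i,\mathbf z_i]\subseteq\mathbb R^d,$$ where the union is over all $\mathbf z\in\mathbb R_{>0}^d$ such that $\mathcal P$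 is compatible with $\mathbf z$, $\mathbf G^{\mathcal P}_{\mathbf z}(m,n)$ is primitive, and $\lambda_1(\mathbf G^{\mathcal P}_{\mathbf z}(m,n))<1$. For $1\le k\le K$ and $\mathbf n\in\mathbb Z_{\ge0}^d$ let $c_{\mathbf n,k}$ be the number of SAWs that start from a fixed vertex in $\mathcal V_k$ and contain exactly $\mathbf n_i$ edges of $\mathcal E_i$ for each $i$, and let $g_k(\mathbf x)=\sum_{\mathbf n\in\mathbb Z_{\ge0}^d}c_{\mathbf n,k}\,\mathbf x^{\mathbf n}$, with $\mathbf x^{\mathbf n}=\prod_i\mathbf x_i^{\mathbf n_i}$, be the anisotropic generating function. \textbf{Statement.} The set $\mathcal D^{\mathcal P}(m,n)$ is open in $\mathbb R^d$, and for every $1\le k\le K$ the series $g_k(\mathbf x)$ converges absolutely at every $\mathbf x\in\mathcal D^{\mathcal P}(m,n)$. Moreover, $g_k$ is (real-)analytic on $\mathcal D^{\mathcal P}(m,n)$. -/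

import Mathlib

namespace SAW

/-- The points of `D`-dimensional Euclidean space. -/
abbrev Pt (D : ℕ) : Type := EuclideanSpace ℝ (Fin D)

/-- An edge drawn in Euclidean space: the set of points of its drawing, and the set of ordered
pairs `(u, v)` such that the edge may be traversed from `u` to `v` (one pair for a directed edge,
a pair and its reverse for an undirected one). -/
@[ext]
structure DrawnEdge (D : ℕ) where
  carrier : Set (Pt D)
  dir : Set (Pt D × Pt D)

namespace DrawnEdge

/-- The translate of a drawn edge by the vector `a`. -/
def translate {D : ℕ} (a : Pt D) (e : DrawnEdge D) : DrawnEdge D where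
  carrier := (fun p => a + p) '' e.carrier
  dir := (fun q => (a + q.1, a + q.2)) '' e.dir

theorem translate_zero {D : ℕ} (e : DrawnEdge D) : translate 0 e = e := by
  ext <;> simp [translate]

theorem translate_add {D : ℕ} (a b : Pt D) (e : DrawnEdge D) :
    translate (a + b) e = translate a (translate b e) := by
  cases e
  simp only [translate, Set.image_image, add_assoc]

end DrawnEdge

/-- A graph drawn in `D`-dimensional Euclidean space. Every edge is directed or undirected, has its
endpoints among the vertices, and is drawn as a curve that joins its endpoints. Parallel edges are
allowed; they are told apart by their drawings. -/
structure DrawnGraph (D : ℕ) where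
  verts : Set (Pt D)
  edges : Set (DrawnEdge D)
  drawn : ∀ e ∈ edges, ∃ u ∈ verts, ∃ v ∈ verts,
    (e.dir = {(u, v)} ∨ e.dir = {(u, v), (v, u)}) ∧
      ∃ c : Path u v, Set.range c = e.carrier

namespace DrawnGraph

variable {D : ℕ} (L : DrawnGraph D)

/-- The type of vertices. -/
abbrev Vertex : Type := L.verts

/-- The type of edges. -/
abbrev Edge : Type := L.edges

/-- The edge `e` can be traversed from `u` to `v`. -/
def Joins (e : L.Edge) (u v : L.Vertex) : Prop :=
  ((u : Pt D), (v : Pt D)) ∈ (e : DrawnEdge D).dir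

/-! ### Translations and equivalence classes -/

/-- The translations of the graph: the vectors `a` such that the translation by `a` maps the set of
vertices onto itself and the set of drawn edges onto itself. -/
def translations : AddSubgroup (Pt D) where
  carrier := {a | (fun p => a + p) '' L.verts = L.verts ∧
    DrawnEdge.translate a '' L.edges = L.edges}
  zero_mem' := by
    constructor
    · simp
    · simp [DrawnEdge.translate_zero]
  add_mem' := by
    rintro a b ⟨ha, ha'⟩ ⟨hb, hb'⟩
    constructor
    · conv_rhs => rw [← ha, ← hb, Set.image_image]
      simp only [add_assoc]
    · conv_rhs => rw [← ha', ← hb', Set.image_image]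
      simp only [DrawnEdge.translate_add]
  neg_mem' := by
    rintro a ⟨ha, ha'⟩
    constructor
    · conv_lhs => rw [← ha, Set.image_image]
      simp
    · conv_lhs => rw [← ha', Set.image_image]
      simp only [← DrawnEdge.translate_add, neg_add_cancel, DrawnEdge.translate_zero,
        Set.image_id']

/-- Two vertices are equivalent if they are related by a translation of the graph. -/
def vertexSetoid : Setoid L.Vertex where
  r u v := ∃ a ∈ L.translations, (v : Pt D) = a + u
  iseqv :=
    { refl := fun u => ⟨0, zero_mem _, by simp⟩
      symm := by
        rintro u v ⟨a, ha, h⟩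
        exact ⟨-a, neg_mem ha, by simp [h]⟩
      trans := by
        rintro u v w ⟨a, ha, h⟩ ⟨b, hb, h'⟩
        exact ⟨b + a, add_mem hb ha, by rw [h', h, add_assoc]⟩ }

/-- Two edges are equivalent if they are related by a translation of the graph. -/
def edgeSetoid : Setoid L.Edge where
  r e f := ∃ a ∈ L.translations, (f : DrawnEdge D) = DrawnEdge.translate a e
  iseqv :=
    { refl := fun e => ⟨0, zero_mem _, by simp [DrawnEdge.translate_zero]⟩
      symm := by
        rintro e f ⟨a, ha, h⟩
        refine ⟨-a, neg_mem ha, ?_⟩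
        rw [h, ← DrawnEdge.translate_add, neg_add_cancel, DrawnEdge.translate_zero]
      trans := by
        rintro e f g ⟨a, ha, h⟩ ⟨b, hb, h'⟩
        exact ⟨b + a, add_mem hb ha, by rw [h', h, DrawnEdge.translate_add]⟩ }

/-- The vertex classes `𝒱₁, …, 𝒱_K`. -/
def VertexClass : Type := Quotient L.vertexSetoid

/-- The edge classes `ℰ₁, …, ℰ_d`. -/
def EdgeClass : Type := Quotient L.edgeSetoid

/-- The class of a vertex. -/
def vertexClass (v : L.Vertex) : L.VertexClass := Quotient.mk L.vertexSetoid v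

/-- The class of an edge. -/
def edgeClass (e : L.Edge) : L.EdgeClass := Quotient.mk L.edgeSetoid e

/-! ### Walks -/

/-- An `n`-step walk `(v₀, e₁, v₁, …, eₙ, vₙ)`; a `0`-step walk is a single vertex. -/
structure Walk (n : ℕ) where
  vert : Fin (n + 1) → L.Vertex
  edge : Fin n → L.Edge
  joins : ∀ i : Fin n, L.Joins (edge i) (vert i.castSucc) (vert i.succ)

/-- The two kinds of self-avoidance: walks with distinct vertices (SAW) and trails, with distinct
edges (SAT). -/
inductive Kind where
  | saw
  | sat

namespace Walk

variable {L}

/-- The starting point of a walk. -/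
def start {n : ℕ} (W : L.Walk n) : L.Vertex := W.vert 0

/-- The final point of a walk. -/
def finish {n : ℕ} (W : L.Walk n) : L.Vertex := W.vert (Fin.last n)

/-- The walk is a SAW, respectively a SAT. -/
def IsAvoiding {n : ℕ} (κ : Kind) (W : L.Walk n) : Prop :=
  match κ with
  | Kind.saw => Function.Injective W.vert
  | Kind.sat => Function.Injective W.edge

/-- The `m`-step piece of a walk that begins after `i` steps. -/
def segment {n : ℕ} (W : L.Walk n) (i m : ℕ) (h : i + m ≤ n) : L.Walk m where
  vert j := W.vert ⟨i + j, by omega⟩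
  edge j := W.edge ⟨i + j, by omega⟩
  joins j := W.joins ⟨i + j, by omega⟩

/-- `W'` is a translation of `W`. -/
def IsTranslate {n : ℕ} (W W' : L.Walk n) : Prop :=
  ∃ a ∈ L.translations, (∀ i, (W'.vert i : Pt D) = a + W.vert i) ∧
    ∀ i, (W'.edge i : DrawnEdge D) = DrawnEdge.translate a (W.edge i)

/-- `N_i(γ)`, the number of edges of the walk `γ` that belong to the edge class `i`. -/
noncomputable def count {n : ℕ} (W : L.Walk n) (i : L.EdgeClass) : ℕ :=
  Nat.card {j : Fin n // L.edgeClass (W.edge j) = i}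

end Walk

/-! ### Lattices -/

/-- The standing assumptions on a lattice: it is infinite, has finitely many vertex classes under
its translations and finite (out-)degrees, and is strongly connected. -/
class IsLattice : Prop where
  infinite : L.verts.Infinite
  finite_vertexClass : Finite L.VertexClass
  finite_degree : ∀ u : L.Vertex, {e : L.Edge | ∃ v, L.Joins e u v}.Finite
  strongly_connected : ∀ u v : L.Vertex, ∃ (n : ℕ) (W : L.Walk n), W.start = u ∧ W.finish = v

instance instFiniteEdgeClass [L.IsLattice] : Finite L.EdgeClass := by
  have h1 : Finite L.VertexClass := IsLattice.finite_vertexClass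
  let rep : L.VertexClass → L.Vertex := fun k => Quotient.out k
  have h2 : ∀ k, Finite {e : L.Edge | ∃ v, L.Joins e (rep k) v} := fun k =>
    (IsLattice.finite_degree (rep k)).to_subtype
  let f : (Σ k : L.VertexClass, {e : L.Edge | ∃ v, L.Joins e (rep k) v}) → L.EdgeClass :=
    fun p => L.edgeClass p.2.1
  refine Finite.of_surjective f ?_
  intro c
  obtain ⟨e, rfl⟩ := Quotient.exists_rep c
  obtain ⟨u, hu, v, hv, hd, -⟩ := L.drawn e.1 e.2
  have huv : (u, v) ∈ e.1.dir := by
    rcases hd with hd | hd <;> rw [hd] <;> simp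
  have hrel : L.vertexSetoid.r ⟨u, hu⟩ (rep (L.vertexClass ⟨u, hu⟩)) :=
    L.vertexSetoid.symm' (Quotient.exact (Quotient.out_eq (L.vertexClass ⟨u, hu⟩)))
  obtain ⟨a, ha, hrep⟩ := hrel
  have hv' : a + v ∈ L.verts :=
    ha.1.subset ⟨v, hv, rfl⟩
  have he' : DrawnEdge.translate a e.1 ∈ L.edges :=
    ha.2.subset ⟨e.1, e.2, rfl⟩
  refine ⟨⟨L.vertexClass ⟨u, hu⟩, ⟨⟨_, he'⟩, ⟨a + v, hv'⟩, ?_⟩⟩, ?_⟩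
  · change ((rep (L.vertexClass ⟨u, hu⟩) : Pt D), a + v) ∈ _
    rw [hrep]
    exact ⟨(u, v), huv, rfl⟩
  · exact Quotient.sound (L.edgeSetoid.symm' ⟨a, ha, rfl⟩)

noncomputable instance instFintypeEdgeClass [L.IsLattice] : Fintype L.EdgeClass :=
  Fintype.ofFinite L.EdgeClass

/-! ### Symmetries -/

/-- A symmetry of the graph: a bijection of the vertices together with a bijection of the edges
that respects incidence. -/
structure Symm where
  onVert : L.Vertex ≃ L.Vertex
  onEdge : L.Edge ≃ L.Edge
  joins_iff : ∀ e u v, L.Joins (onEdge e) (onVert u) (onVert v) ↔ L.Joins e u v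

variable {L}

/-- The symmetry preserves the weights of all edges, where `z i` is the weight of every edge of the
class `i`. -/
def Symm.IsWeightPreserving (τ : L.Symm) (z : L.EdgeClass → ℝ) : Prop :=
  ∀ e, z (L.edgeClass e) = z (L.edgeClass (τ.onEdge e))

/-- The symmetry maps the walk `W` to the walk `W'`. -/
def Symm.MapsTo (τ : L.Symm) {n : ℕ} (W W' : L.Walk n) : Prop :=
  (∀ i, W'.vert i = τ.onVert (W.vert i)) ∧ ∀ i, W'.edge i = τ.onEdge (W.edge i)

/-! ### Weights, partitions and matrices -/

/-- The weight `𝐰(γ) = ∏ᵢ zᵢ ^ N_i(γ)` of a walk. -/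
noncomputable def weight [L.IsLattice] (z : L.EdgeClass → ℝ) {n : ℕ} (W : L.Walk n) : ℝ :=
  ∏ i, z i ^ W.count i

/-- `P` is a partition, into the nonempty parts `P s`, of the set of all `m`-step SAWs (SATs) that
start from one of the representatives `v k` of the vertex classes. -/
structure IsPartition (κ : Kind) (v : L.VertexClass → L.Vertex) {m t : ℕ}
    (P : Fin t → Set (L.Walk m)) : Prop where
  nonempty : ∀ s, (P s).Nonempty
  disjoint : Pairwise fun r s => Disjoint (P r) (P s)
  iUnion_eq : ⋃ s, P s = {W | W.IsAvoiding κ ∧ ∃ k, W.start = v k}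

/-- Any two walks in the same part of `P` are related by a symmetry that is weight-preserving with
respect to `z`. -/
def IsCompatible (z : L.EdgeClass → ℝ) {m t : ℕ} (P : Fin t → Set (L.Walk m)) : Prop :=
  ∀ s, ∀ W ∈ P s, ∀ W' ∈ P s, ∃ τ : L.Symm, τ.IsWeightPreserving z ∧ τ.MapsTo W W'

/-- `𝐅_rs(m,n)`: the sum of the weights of all `n`-step SAWs (SATs) that start with the fixed
`m`-step walk `γ r` and end with a translation of any walk in `P s`. -/
noncomputable def matF [L.IsLattice] (κ : Kind) (z : L.EdgeClass → ℝ) {m n t : ℕ} (hmn : m < n)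
    (P : Fin t → Set (L.Walk m)) (γ : Fin t → L.Walk m) (r s : Fin t) : ℝ :=
  ∑ᶠ W ∈ {W : L.Walk n | W.IsAvoiding κ ∧ W.segment 0 m (by omega) = γ r ∧
    ∃ δ ∈ P s, δ.IsTranslate (W.segment (n - m) m (by omega))}, weight z W

/-- The matrix `𝐆(m,n)` with entries `𝐅_rs(m,n) / 𝐰(γ_r)`. -/
noncomputable def matG [L.IsLattice] (κ : Kind) (z : L.EdgeClass → ℝ) {m n t : ℕ} (hmn : m < n)
    (P : Fin t → Set (L.Walk m)) (γ : Fin t → L.Walk m) : Matrix (Fin t) (Fin t) ℝ :=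
  Matrix.of fun r s => matF κ z hmn P γ r s / weight z (γ r)

/-- `l` is the dominant eigenvalue of the real matrix `A`: it is an eigenvalue, and every other
complex eigenvalue has absolute value strictly less than `l`. -/
def IsDominantEigenvalue {t : ℕ} (A : Matrix (Fin t) (Fin t) ℝ) (l : ℝ) : Prop :=
  Module.End.HasEigenvalue (Matrix.toLin' A) l ∧
    ∀ μ : ℂ, Module.End.HasEigenvalue (Matrix.toLin' (A.map (fun a : ℝ => (a : ℂ)))) μ →
      μ ≠ (l : ℂ) → ‖μ‖ < l

/-- The region `𝒟(m,n)`: the union of the boxes `[-z, z]` over all positive weight vectors `z` for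
which the partition is compatible with `z`, so that `𝐆(m,n)` is defined, and `𝐆(m,n)` is primitive,
so that `λ₁(𝐆(m,n))` is defined, and `λ₁(𝐆(m,n)) < 1`. -/
def region [L.IsLattice] (κ : Kind) {m n t : ℕ} (hmn : m < n)
    (P : Fin t → Set (L.Walk m)) (γ : Fin t → L.Walk m) : Set (L.EdgeClass → ℝ) :=
  ⋃ z ∈ {z : L.EdgeClass → ℝ | (∀ i, 0 < z i) ∧ IsCompatible z P ∧
    (matG κ z hmn P γ).IsPrimitive ∧
    ∃ l : ℝ, IsDominantEigenvalue (matG κ z hmn P γ) l ∧ l < 1}, Set.Icc (-z) z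

/-! ### The anisotropic generating function -/

/-- `c_𝐧`: the number of SAWs (SATs) that start from the vertex `o` and contain exactly `ν i` edges
of the class `i`, for every `i`. Such a walk has `∑ i, ν i` steps. -/
noncomputable def coeff [L.IsLattice] (κ : Kind) (o : L.Vertex) (ν : L.EdgeClass → ℕ) : ℕ :=
  Nat.card {W : L.Walk (∑ i, ν i) // W.IsAvoiding κ ∧ W.start = o ∧ W.count = ν}

/-- The term `c_𝐧 x^𝐧` of the generating function. -/
noncomputable def genTerm [L.IsLattice] (κ : Kind) (o : L.Vertex) (x : L.EdgeClass → ℝ)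
    (ν : L.EdgeClass → ℕ) : ℝ :=
  (coeff κ o ν : ℝ) * ∏ i, x i ^ ν i

end DrawnGraph

end SAW

/-!
Cut an `(N + n - m)`-step SAW that extends `γ r` after its first `n` steps. The last `m` of these
belong, up to translation, to some part `P s`, and they are continued by `N - m` further steps.
Forgetting the avoidance of the first `n - m` steps only adds walks, and a weight-preserving
symmetry carries the continuations to those of `γ s`. Hence, if `a N r` is the total weight of the
`N`-step SAWs that extend `γ r`, divided by the weight of `γ r`, then `a (N + n - m) ≤ G (a N)`
entrywise with `G = matG`. If the dominant eigenvalue of `G` is less than `1`, then `∑ G ^ q`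
converges, hence so does `∑ a N`, and the generating function converges absolutely at `z`.

Multiplying `z` by `c` multiplies `G` by `c ^ (n - m)`, so the conditions on `z` survive for some
`c > 1`. The closed boxes `[-z, z]` may therefore be replaced by the open ones. On an open box,
analyticity is Abel's lemma: a power series that converges absolutely at `z` is analytic on the
open polydisc spanned by `z`.
-/

namespace SAW

/-! ### Absolutely convergent power series in several variables -/

section PowerSeries

variable {ι : Type*} [Fintype ι]

theorem hasSum_sum_piAntidiag [DecidableEq ι] {E : Type*} [AddCommGroup E] [UniformSpace E]
    [IsUniformAddGroup E] [CompleteSpace E] [T2Space E] {f : (ι → ℕ) → E} {s : E}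
    (hf : HasSum f s) : HasSum (fun N => ∑ ν ∈ Finset.univ.piAntidiag N, f ν) s := by
  have hfiber (N : ℕ) : ∑' ν : (fun ν : ι → ℕ => ∑ i, ν i) ⁻¹' {N}, f ν =
      ∑ ν ∈ Finset.univ.piAntidiag N, f ν := by
    rw [← Finset.tsum_subtype']
    exact tsum_congr_set_coe f (by ext ν; simp)
  simpa only [hfiber] using hf.tsum_fiberwise fun ν => ∑ i, ν i

theorem summable_of_summable_sum_piAntidiag [DecidableEq ι] {f : (ι → ℕ) → ℝ} (hf : 0 ≤ f)
    (h : Summable fun N => ∑ ν ∈ Finset.univ.piAntidiag N, f ν) : Summable f := by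
  have hsum : Summable fun N => ∑' ν : (Finset.univ.piAntidiag N : Finset (ι → ℕ)), f ν := by
    simpa only [Finset.tsum_subtype] using h
  exact (summable_partition (s := fun N => {ν : ι → ℕ | ν ∈ Finset.univ.piAntidiag N}) hf
    fun ν => by simp).2 ⟨fun N => (Finset.univ.piAntidiag N : Finset (ι → ℕ)).summable f, hsum⟩

section Monomial

variable {𝕜 : Type*} [NontriviallyNormedField 𝕜] (ν : ι → ℕ) {N : ℕ} (hν : ∑ i, ν i = N)

variable (𝕜) in
/-- A multilinear form in `N` variables whose restriction to the diagonal is the monomial of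
multidegree `ν`, where `N` is the total degree. It depends on the choice of an order of the factors;
it is the building block of `monomialSeries`. -/
noncomputable def monomialMultilinear : ContinuousMultilinearMap 𝕜 (fun _ : Fin N => ι → 𝕜) 𝕜 :=
  have e : (Σ i, Fin (ν i)) ≃ Fin N := Fintype.equivFinOfCardEq (by simp [hν])
  (ContinuousMultilinearMap.mkPiAlgebra 𝕜 (Fin N) 𝕜).compContinuousLinearMap
    fun j => ContinuousLinearMap.proj (e.symm j).1

theorem monomialMultilinear_diag (x : ι → 𝕜) :
    (monomialMultilinear 𝕜 ν hν fun _ => x) = ∏ i, x i ^ ν i := by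
  simp only [monomialMultilinear, ContinuousMultilinearMap.compContinuousLinearMap_apply,
    ContinuousMultilinearMap.mkPiAlgebra_apply, ContinuousLinearMap.proj_apply]
  rw [Equiv.prod_comp _ fun p : Σ i, Fin (ν i) => x p.1, Fintype.prod_sigma]
  simp only [Finset.prod_const, Finset.card_univ, Fintype.card_fin]

theorem norm_monomialMultilinear_le : ‖monomialMultilinear 𝕜 ν hν‖ ≤ 1 := by
  refine ContinuousMultilinearMap.opNorm_le_bound zero_le_one fun y => ?_
  simp only [monomialMultilinear, ContinuousMultilinearMap.compContinuousLinearMap_apply,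
    ContinuousMultilinearMap.mkPiAlgebra_apply, ContinuousLinearMap.proj_apply, norm_prod, one_mul]
  gcongr
  exact norm_le_pi_norm _ _

end Monomial

variable {𝕜 : Type*} [NontriviallyNormedField 𝕜]
  {E : Type*} [NormedAddCommGroup E] [NormedSpace 𝕜 E]

variable (𝕜) in
/-- The formal power series `∑ ν, x ^ ν • a ν` in the variables `x i`, sorted by total degree. -/
noncomputable def monomialSeries [DecidableEq ι] (a : (ι → ℕ) → E) :
    FormalMultilinearSeries 𝕜 (ι → 𝕜) E := fun N =>
  ∑ ν ∈ (Finset.univ.piAntidiag N).attach,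
    (monomialMultilinear 𝕜 ν.1 (Finset.mem_piAntidiag.1 ν.2).1).smulRight (a ν)

theorem monomialSeries_diag [DecidableEq ι] (a : (ι → ℕ) → E) (N : ℕ) (x : ι → 𝕜) :
    (monomialSeries 𝕜 a N fun _ => x) =
      ∑ ν ∈ Finset.univ.piAntidiag N, (∏ i, x i ^ ν i) • a ν := by
  simp only [monomialSeries, sum_apply,
    ContinuousMultilinearMap.smulRight_apply, monomialMultilinear_diag]
  exact Finset.sum_attach _ fun ν => (∏ i, x i ^ ν i) • a ν

theorem norm_monomialSeries_le [DecidableEq ι] (a : (ι → ℕ) → E) (N : ℕ) :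
    ‖monomialSeries 𝕜 a N‖ ≤ ∑ ν ∈ Finset.univ.piAntidiag N, ‖a ν‖ := by
  rw [← Finset.sum_attach]
  refine norm_sum_le_of_le _ fun ν _ => ?_
  rw [ContinuousMultilinearMap.norm_smulRight]
  exact mul_le_of_le_one_left (norm_nonneg _) (norm_monomialMultilinear_le _ _)

variable [CompleteSpace E]

theorem hasFPowerSeriesOnBall_tsum_monomial [DecidableEq ι] {a : (ι → ℕ) → E}
    (ha : Summable fun ν => ‖a ν‖) :
    HasFPowerSeriesOnBall (fun x : ι → 𝕜 => ∑' ν, (∏ i, x i ^ ν i) • a ν)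
      (monomialSeries 𝕜 a) 0 1 where
  r_le := FormalMultilinearSeries.le_radius_of_summable _ <| by
    simpa using Summable.of_nonneg_of_le (fun _ => norm_nonneg _) (norm_monomialSeries_le a)
      (hasSum_sum_piAntidiag ha.hasSum).summable
  r_pos := one_pos
  hasSum {x} hx := by
    have hx1 (i : ι) : ‖x i‖ ≤ 1 := by
      rw [← ENNReal.ofReal_one, Metric.eball_ofReal, mem_ball_zero_iff] at hx
      exact (norm_le_pi_norm x i).trans hx.le
    have hsum : Summable fun ν => (∏ i, x i ^ ν i) • a ν := by
      refine Summable.of_norm_bounded ha fun ν => ?_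
      rw [norm_smul, norm_prod]
      refine mul_le_of_le_one_left (norm_nonneg _) (Finset.prod_le_one (by simp) fun i _ => ?_)
      rw [norm_pow]
      exact pow_le_one₀ (norm_nonneg _) (hx1 i)
    simpa only [zero_add, monomialSeries_diag] using hasSum_sum_piAntidiag hsum.hasSum

theorem analyticAt_tsum_monomial {a : (ι → ℕ) → E} {x z : ι → 𝕜}
    (hz : Summable fun ν => ‖(∏ i, z i ^ ν i) • a ν‖) (hxz : ∀ i, ‖x i‖ < ‖z i‖) :
    AnalyticAt 𝕜 (fun y : ι → 𝕜 => ∑' ν, (∏ i, y i ^ ν i) • a ν) x := by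
  classical
  have hz0 (i : ι) : z i ≠ 0 := norm_pos_iff.1 ((norm_nonneg _).trans_lt (hxz i))
  let scale : (ι → 𝕜) →L[𝕜] (ι → 𝕜) :=
    ContinuousLinearMap.pi fun i => (z i)⁻¹ • ContinuousLinearMap.proj i
  have hscale (y : ι → 𝕜) (ν : ι → ℕ) :
      (∏ i, scale y i ^ ν i) • (∏ i, z i ^ ν i) • a ν = (∏ i, y i ^ ν i) • a ν := by
    rw [smul_smul, ← Finset.prod_mul_distrib]
    congr 1
    refine Finset.prod_congr rfl fun i _ => ?_
    simp [scale, ← mul_pow, mul_right_comm _ (y i), hz0]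
  have hmem : scale x ∈ Metric.eball (0 : ι → 𝕜) 1 := by
    rw [← ENNReal.ofReal_one, Metric.eball_ofReal, mem_ball_zero_iff, pi_norm_lt_iff one_pos]
    intro i
    simpa [scale, inv_mul_lt_one₀ (norm_pos_iff.2 (hz0 i))] using hxz i
  have h := ((hasFPowerSeriesOnBall_tsum_monomial hz).analyticOnNhd _ hmem).comp
    (scale.analyticAt x)
  simpa only [Function.comp_def, hscale] using h

end PowerSeries

/-! ### Dominant eigenvalues and summable matrix powers -/

section Matrix

theorem summable_norm_pow_of_spectralRadius_lt_one {A : Type*} [NormedRing A] [NormedAlgebra ℂ A]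
    [CompleteSpace A] {a : A} (h : spectralRadius ℂ a < 1) : Summable fun q : ℕ => ‖a ^ q‖ := by
  obtain ⟨r, har, hr1⟩ := ENNReal.lt_iff_exists_nnreal_btwn.1 h
  have hr1 : (r : ℝ) < 1 := by exact_mod_cast hr1
  refine Summable.of_norm_bounded_eventually_nat (summable_geometric_of_lt_one r.coe_nonneg hr1) ?_
  have hroot : ∀ᶠ q : ℕ in Filter.atTop, (‖a ^ q‖₊ : ENNReal) ^ (1 / (q : ℝ)) < r :=
    (spectrum.pow_nnnorm_pow_one_div_tendsto_nhds_spectralRadius a).eventually_lt_const har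
  filter_upwards [hroot, Filter.eventually_gt_atTop 0] with q hq hq0
  have hpow : (‖a ^ q‖₊ : ENNReal) ≤ r ^ q := by
    rw [one_div, ENNReal.rpow_inv_lt_iff (by positivity), ENNReal.rpow_natCast] at hq
    exact hq.le
  rw [norm_norm]
  exact_mod_cast hpow

variable {ι : Type*} [Fintype ι] [DecidableEq ι]

theorem summable_pow_of_forall_hasEigenvalue_norm_lt_one {A : Matrix ι ι ℂ}
    (hA : ∀ μ : ℂ, Module.End.HasEigenvalue (Matrix.toLin' A) μ → ‖μ‖ < 1) :
    Summable fun q : ℕ => A ^ q := by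
  let := Matrix.linftyOpNormedRing (n := ι) (α := ℂ)
  let := Matrix.linftyOpNormedAlgebra (n := ι) (R := ℂ) (α := ℂ)
  have : CompleteSpace (Matrix ι ι ℂ) := FiniteDimensional.complete ℂ _
  cases subsingleton_or_nontrivial (Matrix ι ι ℂ)
  · exact summable_zero.congr fun _ => Subsingleton.elim _ _
  have hspec : ∀ μ ∈ spectrum ℂ A, ‖μ‖₊ < 1 := fun μ hμ => by
    refine NNReal.coe_lt_coe.1 (hA μ ?_)
    rwa [Module.End.hasEigenvalue_iff_mem_spectrum, Matrix.spectrum_toLin']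
  have hradius : spectralRadius ℂ A < 1 := by
    simpa only [ENNReal.coe_one] using spectrum.spectralRadius_lt_of_forall_lt A hspec
  exact (summable_norm_pow_of_spectralRadius_lt_one hradius).of_norm

theorem trace_eq_card_mul_of_forall_hasEigenvalue_eq {K : Type*} [Field K] [IsAlgClosed K]
    {A : Matrix ι ι K} {l : K} (hA : ∀ μ, Module.End.HasEigenvalue (Matrix.toLin' A) μ → μ = l) :
    A.trace = Fintype.card ι * l := by
  have hroots : A.charpoly.roots = Multiset.replicate (Fintype.card ι) l := by
    refine Multiset.eq_replicate.2 ⟨?_, fun μ hμ => hA μ ?_⟩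
    · rw [← (IsAlgClosed.splits _).natDegree_eq_card_roots, Matrix.charpoly_natDegree_eq_dim]
    · rw [Module.End.hasEigenvalue_iff_isRoot_charpoly, Matrix.charpoly_toLin']
      exact Polynomial.isRoot_of_mem_roots hμ
  rw [Matrix.trace_eq_sum_roots_charpoly, hroots, Multiset.sum_replicate, nsmul_eq_mul]

theorem hasEigenvalue_smul {K V : Type*} [Field K] [AddCommGroup V] [Module K V]
    {f : Module.End K V} {μ : K} (h : f.HasEigenvalue μ) (c : K) :
    (c • f).HasEigenvalue (c * μ) := by
  obtain ⟨x, hx⟩ := h.exists_hasEigenvector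
  refine Module.End.hasEigenvalue_of_hasEigenvector (x := x)
    (Module.End.hasEigenvector_iff.2 ⟨Module.End.mem_eigenspace_iff.2 ?_, hx.2⟩)
  rw [LinearMap.smul_apply, hx.apply_eq_smul, smul_smul]

theorem isPrimitive_smul {A : Matrix ι ι ℝ} (hA : A.IsPrimitive) {c : ℝ} (hc : 0 < c) :
    (c • A).IsPrimitive := by
  obtain ⟨k, hk, hpos⟩ := hA.exists_pos_pow
  refine ⟨fun r s => mul_nonneg hc.le (hA.nonneg r s), k, hk, fun r s => ?_⟩
  rw [smul_pow]
  exact mul_pos (pow_pos hc k) (hpos r s)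

theorem le_pow_mulVec {A : Matrix ι ι ℝ} (hA : ∀ r s, 0 ≤ A r s) {p : ℕ} {a : ℕ → ι → ℝ}
    (hrec : ∀ N, a (p + N) ≤ A.mulVec (a N)) (j q : ℕ) :
    a (p * q + j) ≤ (A ^ q).mulVec (a j) := by
  induction q with
  | zero => simp
  | succ q ih =>
    calc a (p * (q + 1) + j) = a (p + (p * q + j)) := by ring_nf
      _ ≤ A.mulVec (a (p * q + j)) := hrec _
      _ ≤ A.mulVec ((A ^ q).mulVec (a j)) :=
        fun r => Finset.sum_le_sum fun s _ => mul_le_mul_of_nonneg_left (ih s) (hA r s)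
      _ = (A ^ (q + 1)).mulVec (a j) := by rw [Matrix.mulVec_mulVec, ← pow_succ']

theorem summable_of_summable_mul_add {f : ℕ → ℝ} {p : ℕ} (hp : 0 < p)
    (h : ∀ j, Summable fun q => f (p * q + j)) : Summable f := by
  have : NeZero p := ⟨hp.ne'⟩
  have hclass (k : ZMod p) : Summable ({n : ℕ | (n : ZMod p) = k}.indicator f) := by
    have h := (summable_indicator_mod_iff_summable p k.val f).2 (h k.val)
    rwa [ZMod.natCast_zmod_val] at h
  refine (summable_sum (s := Finset.univ) fun k _ => hclass k).congr fun n => ?_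
  rw [← Finset.sum_apply, ← Finset.sum_indicator_mod p f]

theorem summable_of_le_mulVec {A : Matrix ι ι ℝ} (hA : ∀ r s, 0 ≤ A r s)
    (hsum : Summable fun q : ℕ => A ^ q) {p : ℕ} (hp : 0 < p) {a : ℕ → ι → ℝ} (ha : ∀ N, 0 ≤ a N)
    (hrec : ∀ N, a (p + N) ≤ A.mulVec (a N)) : Summable a := by
  refine Pi.summable.2 fun r => summable_of_summable_mul_add hp fun j => ?_
  have hpow : Summable fun q => (A ^ q).mulVec (a j) r :=
    summable_sum fun s _ => (Pi.summable.1 (Pi.summable.1 hsum r) s).mul_right (a j s)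
  exact hpow.of_nonneg_of_le (fun q => ha _ r) fun q => le_pow_mulVec hA hrec j q r

end Matrix

namespace DrawnGraph

namespace IsDominantEigenvalue

variable {t : ℕ} {A : Matrix (Fin t) (Fin t) ℝ} {l : ℝ}

theorem nonneg (hA : ∀ r s, 0 ≤ A r s) (hl : IsDominantEigenvalue A l) : 0 ≤ l := by
  by_contra! hneg
  have hall (μ : ℂ) (hμ : Module.End.HasEigenvalue (Matrix.toLin' (A.map Complex.ofReal)) μ) :
      μ = l := by
    by_contra hne
    exact (hneg.trans_le (norm_nonneg μ)).not_gt (hl.2 μ hμ hne)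
  have htrace : A.trace = t * l := by
    have h := trace_eq_card_mul_of_forall_hasEigenvalue_eq hall
    rw [Fintype.card_fin] at h
    refine Complex.ofReal_injective ?_
    rw [Complex.ofReal_mul, Complex.ofReal_natCast, ← h]
    exact AddMonoidHom.map_trace Complex.ofRealHom A
  have ht : t ≠ 0 := by
    rintro rfl
    obtain ⟨x, hx⟩ := hl.1.exists_hasEigenvector
    exact hx.2 (Subsingleton.elim x 0)
  have htrace_neg : A.trace < 0 :=
    htrace ▸ mul_neg_of_pos_of_neg (by exact_mod_cast Nat.pos_of_ne_zero ht) hneg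
  exact htrace_neg.not_ge (Finset.sum_nonneg fun i _ => hA i i)

theorem summable_pow (hA : ∀ r s, 0 ≤ A r s) (hl : IsDominantEigenvalue A l) (hl1 : l < 1) :
    Summable fun q : ℕ => A ^ q := by
  have hnorm (μ : ℂ) (hμ : Module.End.HasEigenvalue (Matrix.toLin' (A.map Complex.ofReal)) μ) :
      ‖μ‖ < 1 := by
    by_cases hne : μ = l
    · rwa [hne, Complex.norm_real, Real.norm_of_nonneg (hl.nonneg hA)]
    · exact (hl.2 μ hμ hne).trans hl1
  have hsum := summable_pow_of_forall_hasEigenvalue_norm_lt_one hnorm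
  refine Pi.summable.2 fun r => Pi.summable.2 fun s => Complex.summable_ofReal.1 ?_
  refine (Pi.summable.1 (Pi.summable.1 hsum r) s).congr fun q => ?_
  exact congrFun (congrFun (Matrix.map_pow A Complex.ofRealHom q).symm r) s

theorem smul (hl : IsDominantEigenvalue A l) {c : ℝ} (hc : 0 < c) :
    IsDominantEigenvalue (c • A) (c * l) := by
  have hcC : (c : ℂ) ≠ 0 := Complex.ofReal_ne_zero.2 hc.ne'
  refine ⟨by simpa only [map_smul] using hasEigenvalue_smul hl.1 c, fun μ hμ hne => ?_⟩
  have hmap : A.map Complex.ofReal = (c : ℂ)⁻¹ • (c • A).map Complex.ofReal := by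
    ext r s
    simp [hcC]
  have hμ' : Module.End.HasEigenvalue (Matrix.toLin' (A.map Complex.ofReal)) ((c : ℂ)⁻¹ * μ) := by
    rw [hmap, map_smul]
    exact hasEigenvalue_smul hμ _
  have hlt : ‖(c : ℂ)⁻¹ * μ‖ < l := by
    refine hl.2 _ hμ' fun h => hne ?_
    rw [Complex.ofReal_mul, ← h, mul_inv_cancel_left₀ hcC]
  rwa [norm_mul, norm_inv, Complex.norm_real, Real.norm_of_nonneg hc.le, inv_mul_lt_iff₀ hc]
    at hlt

end IsDominantEigenvalue

/-! ### Walks and their weights -/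

variable {D : ℕ} {L : DrawnGraph D}

attribute [ext] Walk

theorem Joins.unique {e : L.Edge} {u w w' : L.Vertex} (h : L.Joins e u w) (h' : L.Joins e u w') :
    w = w' := by
  obtain ⟨a, -, b, -, hdir, -⟩ := L.drawn e e.2
  refine Subtype.ext ?_
  unfold Joins at h h'
  rcases hdir with hdir | hdir <;> rw [hdir] at h h' <;>
    simp only [Set.mem_insert_iff, Set.mem_singleton_iff, Prod.mk.injEq] at h h' <;> grind

namespace Walk

variable {κ : Kind} {n : ℕ}

theorem eq_of_start_eq_of_edge_eq {W W' : L.Walk n} (hstart : W.start = W'.start)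
    (hedge : W.edge = W'.edge) : W = W' := by
  refine Walk.ext (funext fun i => ?_) hedge
  induction i using Fin.induction with
  | zero => exact hstart
  | succ i ih => exact (W.joins i).unique (by simpa only [ih, hedge] using W'.joins i)

theorem segment_segment (W : L.Walk n) {i j k a b : ℕ} (h : i + a ≤ n) (h' : j + b ≤ a)
    (hk : i + j = k) : (W.segment i a h).segment j b h' = W.segment k b (by omega) := by
  subst hk
  exact Walk.ext (funext fun _ => congrArg W.vert (Fin.ext (Nat.add_assoc ..).symm))
    (funext fun _ => congrArg W.edge (Fin.ext (Nat.add_assoc ..).symm))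

theorem IsAvoiding.segment {W : L.Walk n} (hW : W.IsAvoiding κ) {i a : ℕ} (h : i + a ≤ n) :
    (W.segment i a h).IsAvoiding κ := by
  cases κ <;>
    exact fun j k hjk => Fin.ext (Nat.add_left_cancel (Fin.mk.inj (hW hjk)))

theorem eq_of_segment_eq {p N : ℕ} {W W' : L.Walk (p + N)}
    (hinit : W.segment 0 p (by omega) = W'.segment 0 p (by omega))
    (hfinal : W.segment p N le_rfl = W'.segment p N le_rfl) : W = W' := by
  refine eq_of_start_eq_of_edge_eq (congrArg (fun V : L.Walk p => V.start) hinit)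
    (funext fun j => ?_)
  induction j using Fin.addCases with
  | left j =>
    have hj := congrFun (congrArg edge hinit) j
    simp only [segment, zero_add] at hj
    exact hj
  | right j => exact congrFun (congrArg edge hfinal) j

theorem finite_setOf_start_eq [L.IsLattice] (n : ℕ) (o : L.Vertex) :
    {W : L.Walk n | W.start = o}.Finite := by
  induction n with
  | zero =>
    refine Set.Subsingleton.finite fun W hW W' hW' => ?_
    exact eq_of_start_eq_of_edge_eq (hW.trans hW'.symm) (Subsingleton.elim _ _)
  | succ n ih =>
    have hfiber (V : L.Walk n) (e : L.Edge) :
        {W : L.Walk (n + 1) | W.segment 0 n (by omega) = V ∧ W.edge (Fin.last n) = e}.Finite := by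
      refine Set.Subsingleton.finite fun W hW W' hW' => eq_of_segment_eq (hW.1.trans hW'.1.symm) ?_
      refine eq_of_start_eq_of_edge_eq ?_ (funext fun j => ?_)
      · have hlast := congrArg finish (hW.1.trans hW'.1.symm)
        simp only [finish, segment, zero_add] at hlast
        exact hlast
      · rw [Subsingleton.elim j 0]
        exact hW.2.trans hW'.2.symm
    refine (ih.biUnion fun V _ => (IsLattice.finite_degree V.finish).biUnion fun e _ =>
      hfiber V e).subset fun W hW => ?_
    have hjoins : L.Joins (W.edge (Fin.last n)) (W.segment 0 n (by omega)).finish W.finish := by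
      simp only [finish, segment, zero_add]
      exact W.joins (Fin.last n)
    exact Set.mem_biUnion (show W.segment 0 n _ ∈ _ from hW)
      (Set.mem_biUnion (show W.edge (Fin.last n) ∈ _ from ⟨_, hjoins⟩) ⟨rfl, rfl⟩)

theorem sum_count [L.IsLattice] (W : L.Walk n) : ∑ i, W.count i = n := by
  classical
  have hcard := Finset.card_eq_sum_card_fiberwise (s := Finset.univ)
    (f := fun j => L.edgeClass (W.edge j)) fun _ _ => Finset.mem_coe.2 (Finset.mem_univ _)
  simpa only [Finset.card_univ, Fintype.card_fin, count, Nat.card_eq_fintype_card,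
    Fintype.card_subtype] using hcard.symm

end Walk

section Weight

variable [L.IsLattice] {z : L.EdgeClass → ℝ} {n : ℕ}

theorem weight_eq_prod (z : L.EdgeClass → ℝ) (W : L.Walk n) :
    weight z W = ∏ j, z (L.edgeClass (W.edge j)) := by
  classical
  simp only [weight, Walk.count, Nat.card_eq_fintype_card, Fintype.card_subtype,
    ← Finset.prod_const]
  exact Finset.prod_fiberwise' Finset.univ (fun j => L.edgeClass (W.edge j)) z

theorem weight_pos (hz : ∀ i, 0 < z i) (W : L.Walk n) : 0 < weight z W :=
  Finset.prod_pos fun i _ => pow_pos (hz i) _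

theorem weight_smul (c : ℝ) (z : L.EdgeClass → ℝ) (W : L.Walk n) :
    weight (c • z) W = c ^ n * weight z W := by
  simp [weight_eq_prod, Finset.prod_mul_distrib]

theorem weight_eq_weight_segment_mul (z : L.EdgeClass → ℝ) (W : L.Walk n) {p m : ℕ}
    (hn : p + m = n) : weight z W =
      weight z (W.segment 0 p (by omega)) * weight z (W.segment p m (by omega)) := by
  subst hn
  simp only [weight_eq_prod, Fin.prod_univ_add, Walk.segment, zero_add]
  rfl

end Weight

/-! ### The action of symmetries on walks -/

namespace Symm

variable {n : ℕ}

/-- The action of a symmetry on the walks of a given length. -/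
def walkEquiv (τ : L.Symm) : L.Walk n ≃ L.Walk n where
  toFun W :=
    { vert i := τ.onVert (W.vert i)
      edge i := τ.onEdge (W.edge i)
      joins i := (τ.joins_iff _ _ _).2 (W.joins i) }
  invFun W :=
    { vert i := τ.onVert.symm (W.vert i)
      edge i := τ.onEdge.symm (W.edge i)
      joins i := by
        rw [← τ.joins_iff]
        simpa only [Equiv.apply_symm_apply] using W.joins i }
  left_inv W := by simp
  right_inv W := by simp

theorem MapsTo.walkEquiv_eq {τ : L.Symm} {W W' : L.Walk n} (h : τ.MapsTo W W') :
    τ.walkEquiv W = W' :=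
  Walk.ext (funext fun i => (h.1 i).symm) (funext fun i => (h.2 i).symm)

theorem segment_walkEquiv (τ : L.Symm) (W : L.Walk n) {i a : ℕ} (h : i + a ≤ n) :
    (τ.walkEquiv W).segment i a h = τ.walkEquiv (W.segment i a h) :=
  rfl

theorem isAvoiding_walkEquiv_iff (τ : L.Symm) {κ : Kind} {W : L.Walk n} :
    (τ.walkEquiv W).IsAvoiding κ ↔ W.IsAvoiding κ := by
  cases κ with
  | saw => exact τ.onVert.injective.of_comp_iff W.vert
  | sat => exact τ.onEdge.injective.of_comp_iff W.edge

namespace IsWeightPreserving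

variable {τ : L.Symm} {z : L.EdgeClass → ℝ}

theorem weight_walkEquiv [L.IsLattice] (h : τ.IsWeightPreserving z) (W : L.Walk n) :
    weight z (τ.walkEquiv W) = weight z W := by
  simp only [weight_eq_prod]
  exact Finset.prod_congr rfl fun j _ => (h (W.edge j)).symm

theorem smul (h : τ.IsWeightPreserving z) (c : ℝ) : τ.IsWeightPreserving (c • z) :=
  fun e => congrArg (c * ·) (h e)

end IsWeightPreserving

end Symm

theorem add_mem_verts {a : Pt D} (ha : a ∈ L.translations) (u : L.Vertex) :
    a + (u : Pt D) ∈ L.verts :=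
  ha.1.subset ⟨u, u.2, rfl⟩

theorem translate_mem_edges {a : Pt D} (ha : a ∈ L.translations) (e : L.Edge) :
    DrawnEdge.translate a e ∈ L.edges :=
  ha.2.subset ⟨e, e.2, rfl⟩

/-- A translation of the graph, regarded as a symmetry. -/
def translationSymm {a : Pt D} (ha : a ∈ L.translations) : L.Symm where
  onVert :=
    { toFun u := ⟨a + u, add_mem_verts ha u⟩
      invFun u := ⟨-a + u, add_mem_verts (neg_mem ha) u⟩
      left_inv u := Subtype.ext (neg_add_cancel_left _ _)
      right_inv u := Subtype.ext (add_neg_cancel_left _ _) }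
  onEdge :=
    { toFun e := ⟨DrawnEdge.translate a e, translate_mem_edges ha e⟩
      invFun e := ⟨DrawnEdge.translate (-a) e, translate_mem_edges (neg_mem ha) e⟩
      left_inv e := by simp [← DrawnEdge.translate_add, DrawnEdge.translate_zero]
      right_inv e := by simp [← DrawnEdge.translate_add, DrawnEdge.translate_zero] }
  joins_iff e u w := by simp [Joins, DrawnEdge.translate]

theorem isWeightPreserving_translationSymm {a : Pt D} (ha : a ∈ L.translations)
    (z : L.EdgeClass → ℝ) : (translationSymm ha).IsWeightPreserving z :=
  fun _ => congrArg z (Quotient.sound ⟨a, ha, rfl⟩)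

namespace Walk.IsTranslate

variable {n : ℕ} {W W' : L.Walk n}

theorem symm (h : W.IsTranslate W') : W'.IsTranslate W := by
  obtain ⟨a, ha, hvert, hedge⟩ := h
  refine ⟨-a, neg_mem ha, fun i => ?_, fun i => ?_⟩
  · rw [hvert, neg_add_cancel_left]
  · rw [hedge, ← DrawnEdge.translate_add, neg_add_cancel, DrawnEdge.translate_zero]

theorem exists_mapsTo (h : W.IsTranslate W') (z : L.EdgeClass → ℝ) :
    ∃ τ : L.Symm, τ.IsWeightPreserving z ∧ τ.MapsTo W W' := by
  obtain ⟨a, ha, hvert, hedge⟩ := h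
  exact ⟨translationSymm ha, isWeightPreserving_translationSymm ha z,
    fun i => Subtype.ext (hvert i), fun i => Subtype.ext (hedge i)⟩

end Walk.IsTranslate

theorem isTranslate_walkEquiv_translationSymm {a : Pt D} (ha : a ∈ L.translations) {n : ℕ}
    (W : L.Walk n) : W.IsTranslate ((translationSymm ha).walkEquiv W) :=
  ⟨a, ha, fun _ => rfl, fun _ => rfl⟩

theorem IsCompatible.smul {z : L.EdgeClass → ℝ} {m t : ℕ} {P : Fin t → Set (L.Walk m)}
    (h : IsCompatible z P) (c : ℝ) : IsCompatible (c • z) P :=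
  fun s W hW W' hW' => (h s W hW W' hW').imp fun _ hτ => ⟨hτ.1.smul c, hτ.2⟩

/-- The sets `P s` contain, up to translation, all `m`-step SAWs (SATs). They may overlap, and
no representatives of the vertex classes are fixed. -/
def IsCover (κ : Kind) {m t : ℕ} (P : Fin t → Set (L.Walk m)) : Prop :=
  ∀ W : L.Walk m, W.IsAvoiding κ → ∃ s, ∃ δ ∈ P s, δ.IsTranslate W

theorem IsPartition.isCover {κ : Kind} {v : L.VertexClass → L.Vertex} {m t : ℕ}
    {P : Fin t → Set (L.Walk m)} (hP : IsPartition κ v P) (hv : ∀ k, L.vertexClass (v k) = k) :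
    IsCover κ P := fun W hW => by
  obtain ⟨a, ha, hstart⟩ : L.vertexSetoid.r W.start (v (L.vertexClass W.start)) :=
    Quotient.exact (hv (L.vertexClass W.start)).symm
  have hmem : (translationSymm ha).walkEquiv W ∈ ⋃ s, P s := by
    rw [hP.iUnion_eq]
    exact ⟨(Symm.isAvoiding_walkEquiv_iff _).2 hW, L.vertexClass W.start, Subtype.ext hstart.symm⟩
  obtain ⟨s, hs⟩ := Set.mem_iUnion.1 hmem
  exact ⟨s, _, hs, (isTranslate_walkEquiv_translationSymm ha W).symm⟩

/-! ### Extensions of a walk -/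

namespace Walk

variable {m n N : ℕ}

/-- The first `m` steps of the walk `W` form the walk `V`. -/
def Extends (W : L.Walk N) (V : L.Walk m) : Prop :=
  ∃ h : 0 + m ≤ N, W.segment 0 m h = V

theorem extends_segment (W : L.Walk N) (h : 0 + m ≤ N) : W.Extends (W.segment 0 m h) :=
  ⟨h, rfl⟩

theorem Extends.segment_eq {W : L.Walk N} {V : L.Walk m} (h : W.Extends V) {i a : ℕ}
    (ha : i + a ≤ m) : W.segment i a (ha.trans (by obtain ⟨h, -⟩ := h; omega)) =
      V.segment i a ha := by
  obtain ⟨h, rfl⟩ := h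
  exact (segment_segment W h ha (Nat.zero_add i)).symm

theorem Extends.trans {W : L.Walk N} {U : L.Walk n} {V : L.Walk m} (hWU : W.Extends U)
    (hUV : U.Extends V) : W.Extends V := by
  obtain ⟨h, rfl⟩ := hUV
  exact ⟨_, hWU.segment_eq h⟩

end Walk

section Extensions

open Walk

variable [L.IsLattice] {κ : Kind} {z : L.EdgeClass → ℝ} {m n p N t : ℕ}

theorem finite_setOf_extends (κ : Kind) (N : ℕ) (V : L.Walk m) :
    {W : L.Walk N | W.IsAvoiding κ ∧ W.Extends V}.Finite := by
  refine (finite_setOf_start_eq N V.start).subset ?_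
  rintro W ⟨-, _, rfl⟩
  rfl

/-- The `N`-step SAWs (SATs) whose first steps form the walk `V`. -/
noncomputable def extensions (κ : Kind) (N : ℕ) (V : L.Walk m) : Finset (L.Walk N) :=
  (finite_setOf_extends κ N V).toFinset

theorem mem_extensions {V : L.Walk m} {W : L.Walk N} :
    W ∈ extensions κ N V ↔ W.IsAvoiding κ ∧ W.Extends V :=
  Set.Finite.mem_toFinset _

/-- The total weight of the `N`-step SAWs (SATs) whose first steps form the walk `V`. -/
noncomputable def extWeight (κ : Kind) (z : L.EdgeClass → ℝ) (N : ℕ) (V : L.Walk m) : ℝ :=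
  ∑ W ∈ extensions κ N V, weight z W

/-- The total weight of the `N`-step SAWs (SATs) whose first steps form the walk `V`, relative to
the weight of `V`. Unlike `extWeight`, it satisfies a recurrence with the matrix `matG`. -/
noncomputable def relExtWeight (κ : Kind) (z : L.EdgeClass → ℝ) (N : ℕ) (V : L.Walk m) : ℝ :=
  extWeight κ z N V / weight z V

theorem extWeight_nonneg (hz : ∀ i, 0 < z i) (N : ℕ) (V : L.Walk m) : 0 ≤ extWeight κ z N V :=
  Finset.sum_nonneg fun W _ => (weight_pos hz W).le

theorem relExtWeight_nonneg (hz : ∀ i, 0 < z i) (N : ℕ) (V : L.Walk m) :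
    0 ≤ relExtWeight κ z N V :=
  div_nonneg (extWeight_nonneg hz N V) (weight_pos hz V).le

theorem weight_mul_relExtWeight (hz : ∀ i, 0 < z i) (N : ℕ) (V : L.Walk m) :
    weight z V * relExtWeight κ z N V = extWeight κ z N V :=
  mul_div_cancel₀ _ (weight_pos hz V).ne'

theorem sum_extensions_extWeight (hmn : m ≤ n) (hnN : n ≤ N) (V : L.Walk m) :
    ∑ U ∈ extensions κ n V, extWeight κ z N U = extWeight κ z N V := by
  classical
  have hmaps : ∀ W ∈ extensions κ N V, W.segment 0 n (by omega) ∈ extensions κ n V := by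
    intro W hW
    obtain ⟨havoid, h, rfl⟩ := mem_extensions.1 hW
    exact mem_extensions.2 ⟨havoid.segment _, by omega, segment_segment W _ _ rfl⟩
  refine (Finset.sum_congr rfl fun U hU => ?_).trans
    (Finset.sum_fiberwise_of_maps_to hmaps (weight z))
  refine Finset.sum_congr (Finset.ext fun W => ?_) fun _ _ => rfl
  rw [Finset.mem_filter, mem_extensions, mem_extensions]
  constructor
  · rintro ⟨hW, hWU⟩
    exact ⟨⟨hW, hWU.trans (mem_extensions.1 hU).2⟩, hWU.2⟩
  · rintro ⟨⟨hW, -⟩, rfl⟩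
    exact ⟨hW, W.extends_segment _⟩

-- Cutting off the first `p` steps is injective on the extensions of `U`.
theorem extWeight_add_le (hz : ∀ i, 0 < z i) (hn : p + m = n) (N : ℕ) (U : L.Walk n) :
    extWeight κ z (p + N) U ≤ weight z U * relExtWeight κ z N (U.segment p m hn.le) := by
  classical
  set V := U.segment p m hn.le with hV
  have hweight : ∀ W ∈ extensions κ (p + N) U, weight z W =
      weight z (U.segment 0 p (by omega)) * weight z (W.segment p N le_rfl) := fun W hW => by
    rw [weight_eq_weight_segment_mul z W rfl, (mem_extensions.1 hW).2.segment_eq]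
  have hinj : Set.InjOn (fun W : L.Walk (p + N) => W.segment p N le_rfl)
      (extensions κ (p + N) U : Set (L.Walk (p + N))) := fun W hW W' hW' h =>
    have hp : 0 + p ≤ n := by omega
    eq_of_segment_eq (((mem_extensions.1 hW).2.segment_eq hp).trans
      ((mem_extensions.1 hW').2.segment_eq hp).symm) h
  have himage : (extensions κ (p + N) U).image (fun W => W.segment p N le_rfl) ⊆
      extensions κ N V := by
    refine Finset.image_subset_iff.2 fun W hW => ?_
    obtain ⟨hW, hWU⟩ := mem_extensions.1 hW
    have hN : 0 + n ≤ p + N := hWU.1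
    exact mem_extensions.2 ⟨hW.segment _, by omega,
      (segment_segment W _ _ (Nat.add_zero p)).trans (hWU.segment_eq hn.le)⟩
  calc extWeight κ z (p + N) U
      = weight z (U.segment 0 p (by omega)) *
          ∑ W ∈ (extensions κ (p + N) U).image fun W => W.segment p N le_rfl, weight z W := by
        rw [Finset.sum_image hinj, Finset.mul_sum]
        exact Finset.sum_congr rfl hweight
    _ ≤ weight z (U.segment 0 p (by omega)) * extWeight κ z N V :=
        mul_le_mul_of_nonneg_left (Finset.sum_le_sum_of_subset_of_nonneg himage
          fun W _ _ => (weight_pos hz W).le) (weight_pos hz _).le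
    _ = weight z U * relExtWeight κ z N V := by
        rw [← weight_mul_relExtWeight hz N V, ← mul_assoc, hV,
          ← weight_eq_weight_segment_mul z U hn]

theorem mem_extensions_walkEquiv {τ : L.Symm} {V : L.Walk m} {W : L.Walk N} :
    τ.walkEquiv W ∈ extensions κ N (τ.walkEquiv V) ↔ W ∈ extensions κ N V := by
  simp only [mem_extensions, τ.isAvoiding_walkEquiv_iff, Extends, τ.segment_walkEquiv,
    τ.walkEquiv.apply_eq_iff_eq]

theorem Symm.IsWeightPreserving.relExtWeight_eq {τ : L.Symm} (h : τ.IsWeightPreserving z)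
    {V V' : L.Walk m} (hV : τ.MapsTo V V') (N : ℕ) :
    relExtWeight κ z N V = relExtWeight κ z N V' := by
  rw [← hV.walkEquiv_eq, relExtWeight, relExtWeight, h.weight_walkEquiv]
  congr 1
  exact Finset.sum_equiv τ.walkEquiv (fun _ => mem_extensions_walkEquiv.symm)
    fun W _ => (h.weight_walkEquiv W).symm

end Extensions

/-! ### The recurrence for the relative weights -/

section Recurrence

open Walk

open scoped Classical in
theorem matF_eq_sum [L.IsLattice] (κ : Kind) (z : L.EdgeClass → ℝ) {m n t : ℕ} (hmn : m < n)
    (P : Fin t → Set (L.Walk m)) (γ : Fin t → L.Walk m) (r s : Fin t) :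
    matF κ z hmn P γ r s = ∑ U ∈ extensions κ n (γ r) with
      ∃ δ ∈ P s, δ.IsTranslate (U.segment (n - m) m (by omega)), weight z U := by
  refine finsum_mem_eq_sum_of_inter_support_eq _ (congrArg (· ∩ _) (Set.ext fun U => ?_))
  have hm : m ≤ n := hmn.le
  simp [mem_extensions, Extends, hm, and_assoc]

variable [L.IsLattice] {κ : Kind} {z : L.EdgeClass → ℝ} {m n t : ℕ} {hmn : m < n}
  {P : Fin t → Set (L.Walk m)} {γ : Fin t → L.Walk m}

theorem matG_smul {c : ℝ} (hc : c ≠ 0) :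
    matG κ (c • z) hmn P γ = c ^ (n - m) • matG κ z hmn P γ := by
  classical
  ext r s
  simp only [matG, matF_eq_sum, Matrix.of_apply, Matrix.smul_apply, smul_eq_mul, weight_smul,
    ← Finset.mul_sum, mul_div_mul_comm]
  rw [pow_sub₀ c hc hmn.le, div_eq_mul_inv (c ^ n)]

theorem IsCompatible.relExtWeight_eq (h : IsCompatible z P) {s : Fin t} {δ δ' V : L.Walk m}
    (hδ : δ ∈ P s) (hδ' : δ' ∈ P s) (hV : δ.IsTranslate V) (N : ℕ) :
    relExtWeight κ z N V = relExtWeight κ z N δ' := by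
  obtain ⟨σ, hσ, hσδ⟩ := hV.exists_mapsTo z
  obtain ⟨τ, hτ, hτδ⟩ := h s δ hδ δ' hδ'
  rw [← hσ.relExtWeight_eq hσδ, hτ.relExtWeight_eq hτδ]

open scoped Classical in
theorem IsCover.relExtWeight_le_sum (hP : IsCover κ P) (hz : ∀ i, 0 < z i)
    (h : IsCompatible z P) (hγ : ∀ r, γ r ∈ P r) {V : L.Walk m} (hV : V.IsAvoiding κ) (N : ℕ) :
    relExtWeight κ z N V ≤
      ∑ s, if ∃ δ ∈ P s, δ.IsTranslate V then relExtWeight κ z N (γ s) else 0 := by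
  obtain ⟨s, hs⟩ := hP V hV
  have hterm : relExtWeight κ z N V =
      if ∃ δ ∈ P s, δ.IsTranslate V then relExtWeight κ z N (γ s) else 0 := by
    obtain ⟨δ, hδ, hδV⟩ := hs
    rw [if_pos ⟨δ, hδ, hδV⟩, h.relExtWeight_eq hδ (hγ s) hδV]
  rw [hterm]
  refine Finset.single_le_sum (f := fun s => if ∃ δ ∈ P s, δ.IsTranslate V then
    relExtWeight κ z N (γ s) else 0) (fun r _ => ?_) (Finset.mem_univ s)
  split_ifs
  exacts [relExtWeight_nonneg hz N (γ r), le_rfl]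

theorem IsCover.relExtWeight_add_le (hP : IsCover κ P) (hz : ∀ i, 0 < z i)
    (h : IsCompatible z P) (hγ : ∀ r, γ r ∈ P r) {N : ℕ} (hN : m ≤ N) (r : Fin t) :
    relExtWeight κ z (n - m + N) (γ r) ≤
      (matG κ z hmn P γ).mulVec (fun s => relExtWeight κ z N (γ s)) r := by
  classical
  have hn : n - m + m = n := by omega
  have hcut : extWeight κ z (n - m + N) (γ r) ≤
      ∑ s, matF κ z hmn P γ r s * relExtWeight κ z N (γ s) :=
    calc extWeight κ z (n - m + N) (γ r)
        = ∑ U ∈ extensions κ n (γ r), extWeight κ z (n - m + N) U :=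
          (sum_extensions_extWeight hmn.le (by omega) _).symm
      _ ≤ ∑ U ∈ extensions κ n (γ r), weight z U *
            ∑ s, if ∃ δ ∈ P s, δ.IsTranslate (U.segment (n - m) m hn.le) then
              relExtWeight κ z N (γ s) else 0 :=
          Finset.sum_le_sum fun U hU => (extWeight_add_le hz hn N U).trans <|
            mul_le_mul_of_nonneg_left (hP.relExtWeight_le_sum hz h hγ
              ((mem_extensions.1 hU).1.segment _) N) (weight_pos hz U).le
      _ = ∑ s, matF κ z hmn P γ r s * relExtWeight κ z N (γ s) := by
          simp only [matF_eq_sum, Finset.mul_sum, Finset.sum_mul, Finset.sum_filter, mul_ite,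
            mul_zero, ite_mul, zero_mul]
          exact Finset.sum_comm
  calc relExtWeight κ z (n - m + N) (γ r)
      ≤ (∑ s, matF κ z hmn P γ r s * relExtWeight κ z N (γ s)) / weight z (γ r) :=
        div_le_div_of_nonneg_right hcut (weight_pos hz _).le
    _ = (matG κ z hmn P γ).mulVec (fun s => relExtWeight κ z N (γ s)) r := by
        simp only [Matrix.mulVec, dotProduct, matG, Matrix.of_apply, Finset.sum_div,
          div_mul_eq_mul_div]

end Recurrence

/-! ### The region of admissible weights -/

section Region

variable [L.IsLattice] {κ : Kind} {z : L.EdgeClass → ℝ} {m n t : ℕ} {hmn : m < n}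
  {P : Fin t → Set (L.Walk m)} {γ : Fin t → L.Walk m}

/-- The weight vector `z` is one of those that define the boxes `[-z, z]` of the region `𝒟(m,n)`. -/
structure IsAdmissible (κ : Kind) (hmn : m < n) (P : Fin t → Set (L.Walk m))
    (γ : Fin t → L.Walk m) (z : L.EdgeClass → ℝ) : Prop where
  pos : ∀ i, 0 < z i
  isCompatible : IsCompatible z P
  isPrimitive : (matG κ z hmn P γ).IsPrimitive
  exists_isDominantEigenvalue : ∃ l : ℝ, IsDominantEigenvalue (matG κ z hmn P γ) l ∧ l < 1

namespace IsAdmissible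

theorem exists_one_lt_smul (h : IsAdmissible κ hmn P γ z) :
    ∃ c : ℝ, 1 < c ∧ IsAdmissible κ hmn P γ (c • z) := by
  obtain ⟨l, hl, hl1⟩ := h.exists_isDominantEigenvalue
  have hlim : Filter.Tendsto (fun c : ℝ => c ^ (n - m) * l) (nhdsWithin 1 (Set.Ioi 1)) (nhds l) :=
    Filter.Tendsto.mono_left ((by fun_prop : Continuous _).tendsto' _ _ (by simp))
      nhdsWithin_le_nhds
  obtain ⟨c, hcl, hc1⟩ := ((hlim.eventually_lt_const hl1).and self_mem_nhdsWithin).exists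
  have hc : 0 < c := one_pos.trans hc1
  have hG := matG_smul (κ := κ) (z := z) (hmn := hmn) (P := P) (γ := γ) hc.ne'
  exact ⟨c, hc1,
    { pos := fun i => mul_pos hc (h.pos i)
      isCompatible := h.isCompatible.smul c
      isPrimitive := hG ▸ isPrimitive_smul h.isPrimitive (pow_pos hc _)
      exists_isDominantEigenvalue := ⟨_, hG ▸ hl.smul (pow_pos hc _), hcl⟩ }⟩

theorem summable_relExtWeight (h : IsAdmissible κ hmn P γ z) (hP : IsCover κ P)
    (hγ : ∀ r, γ r ∈ P r) (r : Fin t) : Summable fun N => relExtWeight κ z N (γ r) := by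
  obtain ⟨l, hl, hl1⟩ := h.exists_isDominantEigenvalue
  have hG := h.isPrimitive.nonneg
  have hshift : Summable fun N s => relExtWeight κ z (N + m) (γ s) :=
    summable_of_le_mulVec hG (hl.summable_pow hG hl1) (Nat.sub_pos_of_lt hmn)
      (fun N s => relExtWeight_nonneg h.pos _ _) fun N s => by
        rw [Nat.add_assoc]
        exact hP.relExtWeight_add_le h.pos h.isCompatible hγ (Nat.le_add_left m N) s
  exact (summable_nat_add_iff m).1 (Pi.summable.1 hshift r)

theorem summable_extWeight (h : IsAdmissible κ hmn P γ z) (hP : IsCover κ P)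
    (hγ : ∀ r, γ r ∈ P r) {k : ℕ} (hkm : k ≤ m) (V : L.Walk k) :
    Summable fun N => extWeight κ z N V := by
  have hU : ∀ U ∈ extensions κ m V, Summable fun N => extWeight κ z N U := fun U hU => by
    obtain ⟨s, δ, hδ, hδU⟩ := hP U (mem_extensions.1 hU).1
    simp only [← weight_mul_relExtWeight h.pos _ U,
      h.isCompatible.relExtWeight_eq hδ (hγ s) hδU]
    exact (h.summable_relExtWeight hP hγ s).mul_left _
  refine (summable_nat_add_iff m).1 (((summable_nat_add_iff m).2 (summable_sum hU)).congr
    fun N => ?_)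
  exact sum_extensions_extWeight hkm (Nat.le_add_left m N) V

end IsAdmissible

theorem mem_region_iff {x : L.EdgeClass → ℝ} :
    x ∈ region κ hmn P γ ↔ ∃ z, IsAdmissible κ hmn P γ z ∧ ∀ i, |x i| < z i := by
  simp only [region, Set.mem_iUnion, Set.mem_ofPred_eq, exists_prop]
  constructor
  · rintro ⟨z, ⟨hpos, hcompat, hprim, hdom⟩, hxz⟩
    have hz : IsAdmissible κ hmn P γ z := ⟨hpos, hcompat, hprim, hdom⟩
    obtain ⟨c, hc, hcz⟩ := hz.exists_one_lt_smul
    exact ⟨c • z, hcz, fun i =>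
      (abs_le.2 ⟨hxz.1 i, hxz.2 i⟩).trans_lt (lt_mul_of_one_lt_left (hpos i) hc)⟩
  · rintro ⟨z, hz, hxz⟩
    exact ⟨z, ⟨hz.pos, hz.isCompatible, hz.isPrimitive, hz.exists_isDominantEigenvalue⟩,
      fun i => (abs_lt.1 (hxz i)).1.le, fun i => (abs_lt.1 (hxz i)).2.le⟩

theorem isOpen_region (κ : Kind) (hmn : m < n) (P : Fin t → Set (L.Walk m))
    (γ : Fin t → L.Walk m) : IsOpen (region κ hmn P γ) := by
  have hunion : region κ hmn P γ =
      ⋃ z ∈ {z | IsAdmissible κ hmn P γ z}, {x | ∀ i, |x i| < z i} := by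
    ext x
    simp only [mem_region_iff, Set.mem_iUnion, Set.mem_ofPred_eq, exists_prop]
  rw [hunion]
  refine isOpen_biUnion fun z _ => ?_
  simp only [Set.ofPred_forall]
  exact isOpen_iInter_of_finite fun i => isOpen_lt (by fun_prop) continuous_const

end Region

/-! ### Convergence of the generating function -/

namespace Walk

/-- The `0`-step walk at the vertex `o`. -/
def nil (o : L.Vertex) : L.Walk 0 where
  vert _ := o
  edge i := i.elim0
  joins i := i.elim0

end Walk

section GeneratingFunction

open Walk

variable [L.IsLattice] {κ : Kind} {z : L.EdgeClass → ℝ}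

theorem mem_extensions_nil {o : L.Vertex} {N : ℕ} {W : L.Walk N} :
    W ∈ extensions κ N (nil o) ↔ W.IsAvoiding κ ∧ W.start = o := by
  refine mem_extensions.trans (and_congr_right fun _ => ?_)
  constructor
  · rintro ⟨_, h⟩
    exact congrArg start h
  · rintro rfl
    exact ⟨by omega, eq_of_start_eq_of_edge_eq rfl (Subsingleton.elim _ _)⟩

open scoped Classical in
theorem genTerm_eq_sum {o : L.Vertex} {ν : L.EdgeClass → ℕ} {N : ℕ} (hν : ∑ i, ν i = N) :
    genTerm κ o z ν = ∑ W ∈ extensions κ N (nil o) with W.count = ν, weight z W := by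
  subst hν
  have hcoeff : coeff κ o ν =
      ((extensions κ (∑ i, ν i) (nil o)).filter fun W => W.count = ν).card :=
    Nat.subtype_card _ fun W => by
      rw [Finset.mem_filter, mem_extensions_nil, and_assoc]
  rw [genTerm, hcoeff, ← nsmul_eq_mul]
  refine (Finset.sum_eq_card_nsmul fun W hW => ?_).symm
  rw [weight, (Finset.mem_filter.1 hW).2]

theorem sum_piAntidiag_genTerm [DecidableEq L.EdgeClass] (o : L.Vertex) (N : ℕ) :
    ∑ ν ∈ Finset.univ.piAntidiag N, genTerm κ o z ν = extWeight κ z N (nil o) := by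
  classical
  refine (Finset.sum_congr rfl fun ν hν => genTerm_eq_sum (Finset.mem_piAntidiag.1 hν).1).trans ?_
  exact Finset.sum_fiberwise_of_maps_to
    (fun W _ => Finset.mem_piAntidiag.2 ⟨W.sum_count, fun _ _ => Finset.mem_univ _⟩) _

theorem norm_genTerm (o : L.Vertex) (x : L.EdgeClass → ℝ) (ν : L.EdgeClass → ℕ) :
    ‖genTerm κ o x ν‖ = coeff κ o ν * ∏ i, |x i| ^ ν i := by
  simp only [genTerm, norm_mul, norm_prod, norm_pow, Real.norm_eq_abs, Nat.abs_cast]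

theorem norm_genTerm_le_norm_genTerm {x : L.EdgeClass → ℝ} (hxz : ∀ i, |x i| ≤ |z i|)
    (o : L.Vertex) (ν : L.EdgeClass → ℕ) : ‖genTerm κ o x ν‖ ≤ ‖genTerm κ o z ν‖ := by
  rw [norm_genTerm, norm_genTerm]
  gcongr ?_ * ∏ i, ?_ ^ _
  exact hxz _

variable {m n t : ℕ} {hmn : m < n} {P : Fin t → Set (L.Walk m)} {γ : Fin t → L.Walk m}

theorem IsAdmissible.summable_norm_genTerm (h : IsAdmissible κ hmn P γ z) (hP : IsCover κ P)
    (hγ : ∀ r, γ r ∈ P r) (o : L.Vertex) : Summable fun ν => ‖genTerm κ o z ν‖ := by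
  classical
  have hnonneg : 0 ≤ genTerm κ o z := fun ν =>
    mul_nonneg (Nat.cast_nonneg _) (Finset.prod_nonneg fun i _ => pow_nonneg (h.pos i).le _)
  refine (summable_of_summable_sum_piAntidiag hnonneg ?_).norm
  simp only [sum_piAntidiag_genTerm]
  exact h.summable_extWeight hP hγ (Nat.zero_le m) (nil o)

theorem IsAdmissible.analyticAt_tsum_genTerm (h : IsAdmissible κ hmn P γ z) (hP : IsCover κ P)
    (hγ : ∀ r, γ r ∈ P r) (o : L.Vertex) {x : L.EdgeClass → ℝ} (hxz : ∀ i, |x i| < z i) :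
    AnalyticAt ℝ (fun y => ∑' ν, genTerm κ o y ν) x := by
  have hterm (y : L.EdgeClass → ℝ) (ν : L.EdgeClass → ℕ) :
      genTerm κ o y ν = (∏ i, y i ^ ν i) • (coeff κ o ν : ℝ) := mul_comm _ _
  simp only [hterm]
  refine analyticAt_tsum_monomial (z := z) ?_ fun i => (hxz i).trans_le (le_abs_self _)
  simpa only [hterm] using h.summable_norm_genTerm hP hγ o

end GeneratingFunction

end DrawnGraph

end SAW

open SAW.DrawnGraph in
theorem corollary3_general {D : ℕ} {L : SAW.DrawnGraph D} [L.IsLattice] {κ : Kind} {m n : ℕ}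
    (hmn : m < n) {t : ℕ} {P : Fin t → Set (L.Walk m)} (hP : IsCover κ P)
    {γ : Fin t → L.Walk m} (hγ : ∀ r, γ r ∈ P r) :
    IsOpen (region κ hmn P γ) ∧
    ∀ o : L.Vertex,
      (∀ x ∈ region κ hmn P γ, Summable fun ν => ‖genTerm κ o x ν‖) ∧
      AnalyticOnNhd ℝ (fun x => ∑' ν, genTerm κ o x ν) (region κ hmn P γ) := by
  refine ⟨isOpen_region κ hmn P γ, fun o => ⟨fun x hx => ?_, fun x hx => ?_⟩⟩
  · obtain ⟨z, hz, hxz⟩ := mem_region_iff.1 hx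
    exact (hz.summable_norm_genTerm hP hγ o).of_nonneg_of_le (fun _ => norm_nonneg _)
      (norm_genTerm_le_norm_genTerm (fun i => (hxz i).le.trans (le_abs_self _)) o)
  · obtain ⟨z, hz, hxz⟩ := mem_region_iff.1 hx
    exact hz.analyticAt_tsum_genTerm hP hγ o hxz

theorem corollary3 {D : ℕ} (L : SAW.DrawnGraph D) [L.IsLattice]
    (κ : SAW.DrawnGraph.Kind)
    (v : L.VertexClass → L.Vertex) (hv : ∀ k, L.vertexClass (v k) = k)
    (m n : ℕ) (hmn : m < n)
    (t : ℕ) (P : Fin t → Set (L.Walk m)) (hP : SAW.DrawnGraph.IsPartition κ v P)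
    (γ : Fin t → L.Walk m) (hγ : ∀ r, γ r ∈ P r) :
    IsOpen (SAW.DrawnGraph.region κ hmn P γ) ∧
    ∀ (k : L.VertexClass) (o : L.Vertex), L.vertexClass o = k →
      (∀ x ∈ SAW.DrawnGraph.region κ hmn P γ,
        Summable fun ν : L.EdgeClass → ℕ => ‖SAW.DrawnGraph.genTerm κ o x ν‖) ∧
      AnalyticOnNhd ℝ
        (fun x : L.EdgeClass → ℝ => ∑' ν : L.EdgeClass → ℕ, SAW.DrawnGraph.genTerm κ o x ν)
        (SAW.DrawnGraph.region κ hmn P γ) :=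
  have ⟨hopen, hgen⟩ := corollary3_general hmn (hP.isCover hv) hγ
  ⟨hopen, fun _ o _ => hgen o⟩
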